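/- Let $\mathcal H$ be the space of real-valued $f\in L^2(\mathbb R)$ whose Fourier transform (in the angular frequency variable) is supported on $[-\pi,\pi]$, with the $L^2$ inner product and norm. For $n\in\mathbb Z$ let $$\varphi_n(x)=\frac{\sin\left(\pi(x-\frac n4)\right)}{\pi(x-\frac n4)}\quad (x\neq \tfrac n4),\qquad \varphi_n(\tfrac n4)=1,$$ let $\Phi=\{\varphi_n\}_{n\in\mathbb Z}$, and put $\mathcal A_\Phi(f)=(|\langle f,\varphi_n\rangle|)_{n\in\mathbb Z}\in\ell^2(\mathbb Z)$. Then $\Phi$ is a frame for $\mathcal H$; it does phase retrieval for $\mathcal H$ (that is, if $f,g\in\mathcal H$ and $\mathcal A_\Phi(f)=\mathcal A_\Phi(g)$, then $f=\pm g$); and $\{\varphi_{4\ell}\}_{\ell\in\mathbb Z}$ is an orthonormal basis of $\mathcal H$. For $n\in\mathbb N=\{0,1,2,\dots\}$ let $V_n\subset\mathcal H$ be the $(2n+1)$-dimensional span of the $\varphi_{4\ell}$, $-n\le\ell\le n$, and for $m\in\mathbb N$ let $$f_m=\sum_{\ell=0}^m\binom m\ell\left[\varphi_{4(-2m+\ell)}+\varphi_{4(2m-\ell)}\right],\qquad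 g_m=\sum_{\ell=0}^m\binom m\ell\left[\varphi_{4(-2m+\ell)}-\varphi_{4(2m-\ell)}\right].$$ Then $f_m,g_m\in V_{2m}$, and for each $m$ there is a constant $K_m$ with $|f_m(x)|,|g_m(x)|\le K_m(1+|x|)^{-(m+1)}$ for almost every $x\in\mathbb R$. Moreover there is a constant $C>0$, independent of $m$, such that for all $m\in\mathbb N$ $$\inf_{\alpha\in\{1,-1\}}\|f_m-\alpha g_m\|>C\,(m+1)^{-1}\,2^{3m}\,\|\mathcal A_\Phi(f_m)-\mathcal A_\Phi(g_m)\|_{\ell^2}.$$ Consequently, if $G:\mathbb N\to\mathbb R$ is any function such that for every $k\in\mathbb N$ $$\inf_{\alpha\in\{1,-1\}}\|f-\alpha g\|\le G(k)\,\|\mathcal A_\Phi(f)-\mathcal A_\Phi(g)\|_{\ell^2}\quad\text{for all } f,g\in V_k,$$ then $G(k)>C\,(m+1)^{-1}\,2^{3m}$ for all $m,k\in\mathbb N$ with $2m\le k$; so $G$ grows exponentially. -/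

import Mathlib

open MeasureTheory
open scoped FourierTransform

noncomputable section

namespace SincFrame

/-- Real-valued square integrable functions on the line. -/
abbrev L2R : Type := Lp ℝ 2 (volume : Measure ℝ)

/-- A real `L²` function regarded as a complex `L²` function. -/
def complexify : L2R →L[ℝ] Lp ℂ 2 (volume : Measure ℝ) :=
  Complex.ofRealCLM.compLpL 2 volume

/-- The real `L²` functions with bandlimit `π`. Mathlib's `𝓕` has the kernel `exp (-2πixξ)`, so
the angular frequency that belongs to `ξ` is `2πξ`; the Fourier transform has to vanish almost
everywhere where the angular frequency lies outside `[-π, π]`. -/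
def bandlimited : Submodule ℝ L2R where
  carrier := {f | ∀ᵐ ξ : ℝ, 2 * Real.pi * ξ ∉ Set.Icc (-Real.pi) Real.pi →
    (𝓕 (complexify f) : Lp ℂ 2 (volume : Measure ℝ)) ξ = 0}
  zero_mem' := by
    have h : (𝓕 (complexify 0) : Lp ℂ 2 (volume : Measure ℝ)) = 0 := by
      rw [map_zero]
      exact (Lp.fourierTransformₗᵢ ℝ ℂ).map_zero
    rw [Set.mem_ofPred_eq, h]
    filter_upwards [Lp.coeFn_zero ℂ 2 (volume : Measure ℝ)] with ξ _ _
    simp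
  add_mem' := by
    intro f g hf hg
    have h : (𝓕 (complexify (f + g)) : Lp ℂ 2 (volume : Measure ℝ)) =
        𝓕 (complexify f) + 𝓕 (complexify g) := by
      rw [map_add]
      exact (Lp.fourierTransformₗᵢ ℝ ℂ).map_add _ _
    rw [Set.mem_ofPred_eq] at hf hg ⊢
    rw [h]
    filter_upwards [hf, hg, Lp.coeFn_add (𝓕 (complexify f) : Lp ℂ 2 (volume : Measure ℝ))
      (𝓕 (complexify g))] with ξ h1 h2 h3 h4
    rw [h3, Pi.add_apply, h1 h4, h2 h4, add_zero]
  smul_mem' := by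
    intro c f hf
    have h : (𝓕 (complexify (c • f)) : Lp ℂ 2 (volume : Measure ℝ)) =
        (c : ℂ) • 𝓕 (complexify f) := by
      rw [map_smul]
      exact (Lp.fourierTransformₗᵢ ℝ ℂ).map_smul (c : ℂ) _
    rw [Set.mem_ofPred_eq] at hf ⊢
    rw [h]
    filter_upwards [hf, Lp.coeFn_smul (c : ℂ) (𝓕 (complexify f) : Lp ℂ 2 (volume : Measure ℝ))]
      with ξ h1 h3 h4
    rw [h3, Pi.smul_apply, h1 h4, smul_zero]

/-- `x ↦ sin (π (x - n/4)) / (π (x - n/4))`, with the value `1` at `x = n/4`. -/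
def sincFun (n : ℤ) (x : ℝ) : ℝ := Real.sinc (Real.pi * (x - n / 4))

theorem sq_sinc_le (y : ℝ) : Real.sinc y ^ 2 ≤ 2 * (1 + y ^ 2)⁻¹ := by
  have h1 : Real.sinc y ^ 2 ≤ 1 := by
    rw [← sq_abs]
    exact pow_le_one₀ (abs_nonneg _) (Real.abs_sinc_le_one y)
  have h2 : (y * Real.sinc y) ^ 2 ≤ 1 := by
    by_cases hy : y = 0
    · simp [hy]
    · rw [Real.sinc_of_ne_zero hy, mul_div_cancel₀ _ hy]
      exact Real.sin_sq_le_one y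
  rw [← div_eq_mul_inv, le_div_iff₀ (by positivity)]
  nlinarith

theorem memLp_sincFun (n : ℤ) : MemLp (sincFun n) 2 (volume : Measure ℝ) := by
  have hc : Continuous (sincFun n) := by
    unfold sincFun
    exact Real.continuous_sinc.comp (by fun_prop)
  rw [memLp_two_iff_integrable_sq hc.aestronglyMeasurable]
  have hi : Integrable (fun x : ℝ => 2 * (1 + (Real.pi * (x - n / 4)) ^ 2)⁻¹) := by
    have h0 := (integrable_inv_one_add_sq.comp_mul_left' Real.pi_ne_zero).comp_sub_right
      ((n : ℝ) / 4)
    exact h0.const_mul 2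
  refine hi.mono' (hc.pow 2).aestronglyMeasurable (Filter.Eventually.of_forall fun x => ?_)
  rw [Real.norm_of_nonneg (sq_nonneg _)]
  exact sq_sinc_le _

/-- The functions `φ_n`, `n ∈ ℤ`, as elements of `L²`. -/
def phi (n : ℤ) : L2R := (memLp_sincFun n).toLp (sincFun n)

/-- `V_n`, the span of `φ_{4ℓ}` for `-n ≤ ℓ ≤ n`. -/
def V (n : ℕ) : Submodule ℝ L2R :=
  Submodule.span ℝ ((fun l : ℤ => phi (4 * l)) '' Set.Icc (-(n : ℤ)) n)

/-- `f_m = ∑_{ℓ=0}^m (m choose ℓ) (φ_{4(-2m+ℓ)} + φ_{4(2m-ℓ)})`. -/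
def f (m : ℕ) : L2R :=
  ∑ l ∈ Finset.range (m + 1),
    (m.choose l : ℝ) • (phi (4 * (-2 * (m : ℤ) + l)) + phi (4 * (2 * (m : ℤ) - l)))

/-- `g_m = ∑_{ℓ=0}^m (m choose ℓ) (φ_{4(-2m+ℓ)} - φ_{4(2m-ℓ)})`. -/
def g (m : ℕ) : L2R :=
  ∑ l ∈ Finset.range (m + 1),
    (m.choose l : ℝ) • (phi (4 * (-2 * (m : ℤ) + l)) - phi (4 * (2 * (m : ℤ) - l)))

section General

variable {ι E : Type*} [NormedAddCommGroup E] [InnerProductSpace ℝ E]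

/-- `Φ` is a frame for the subspace `H`. -/
def IsFrameFor (Φ : ι → E) (H : Submodule ℝ E) : Prop :=
  (∀ n, Φ n ∈ H) ∧ ∃ A B : ℝ, 0 < A ∧ A ≤ B ∧ ∀ u ∈ H,
    Summable (fun n => |inner ℝ u (Φ n)| ^ 2) ∧
    A * ‖u‖ ^ 2 ≤ ∑' n, |inner ℝ u (Φ n)| ^ 2 ∧
    ∑' n, |inner ℝ u (Φ n)| ^ 2 ≤ B * ‖u‖ ^ 2

/-- The phaseless measurements `𝓐_Φ(u) = (|⟨u, φ_n⟩|)_n`. -/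
def amplitude (Φ : ι → E) (u : E) (n : ι) : ℝ := |inner ℝ u (Φ n)|

/-- `Φ` does phase retrieval for the real subspace `H`. -/
def DoesPhaseRetrieval (Φ : ι → E) (H : Submodule ℝ E) : Prop :=
  ∀ u ∈ H, ∀ v ∈ H, amplitude Φ u = amplitude Φ v → ∃ α : ℝ, |α| = 1 ∧ u = α • v

/-- The `ℓ²` distance `‖𝓐_Φ(u) - 𝓐_Φ(v)‖`; for a frame the series converges. -/
def amplitudeDist (Φ : ι → E) (u v : E) : ℝ :=
  √(∑' n, (amplitude Φ u n - amplitude Φ v n) ^ 2)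

/-- `inf_{α ∈ {1, -1}} ‖u - α v‖`. -/
def signDist (u v : E) : ℝ := ⨅ α : ({1, -1} : Set ℝ), ‖u - (α : ℝ) • v‖

end General

end SincFrame

end

/-! In ordinary frequency, bandlimited means spectrum in `[-1/2, 1/2]`, and `⟨u, φ_n⟩` is the sample
`u(n/4)`. Parseval for Fourier series on `[-r, r]` (`hasSum_norm_sq_fourierInv`) gives a tight frame
with bound 4 for `r = 2`, and Parseval's identity for the `φ_{4ℓ}` for `r = 1/2`.

Phase retrieval: equal amplitudes make `(u - v)(u + v)` vanish at all quarter integers. This product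
has spectrum in `[-1, 1]`, so it is oversampled and vanishes identically; both factors are analytic,
hence one of them is zero.

Instability: write `f_m = L + R` and `g_m = L - R`. Then `f_m - g_m = 2R` and `f_m + g_m = 2L`,
where `‖L‖² = ‖R‖² = c`, the central binomial coefficient `(2m choose m)`. The amplitudes differ by
at most `2 min(|L|, |R|)`. Since `sin π(y - ℓ) = (-1)^ℓ sin πy`, a binomial sum of sincs is an
`m`-th finite difference of `1/y`, so it decays to order `m + 1` (`prod_mul_binomialSinc`). On the
half-line of the other bump, each half is therefore at most `1/c` times a single sinc. The amplitude
distance is `O(1/c)`, and the quotient is at least a multiple of `c^{3/2}`, that is, of `8^m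
(m+1)^{-3/4}`. -/

noncomputable section

namespace SincFrame

/-! ### Fourier inversion on `L¹ ∩ L²` and Parseval for samples -/

section FourierL2

open SchwartzMap

theorem fourierInv_real_eq_integral_exp_mul (F : ℝ → ℂ) (x : ℝ) :
    𝓕⁻ F x = ∫ ξ : ℝ, Complex.exp (2 * Real.pi * ξ * x * Complex.I) * F ξ := by
  rw [Real.fourierInv_eq']
  refine integral_congr_ae (Filter.Eventually.of_forall fun ξ => ?_)
  simp only [smul_eq_mul]
  congr 2
  simp
  ring

theorem integrable_exp_mul {F : ℝ → ℂ} (hF : Integrable F) (x : ℝ) :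
    Integrable fun ξ : ℝ => Complex.exp (2 * Real.pi * ξ * x * Complex.I) * F ξ := by
  refine hF.bdd_mul (c := 1) (by fun_prop) (Filter.Eventually.of_forall fun ξ => ?_)
  have h := Complex.norm_exp_ofReal_mul_I (2 * Real.pi * ξ * x)
  push_cast at h
  exact h.le

theorem continuous_fourierInv_of_integrable {F : ℝ → ℂ} (hF : Integrable F) :
    Continuous (𝓕⁻ F) := by
  have h : Continuous (𝓕 F) :=
    VectorFourier.fourierIntegral_continuous Real.continuous_fourierChar
      (by exact continuous_inner) hF
  have h2 : 𝓕⁻ F = fun x => 𝓕 F (-x) := funext fun x => Real.fourierInv_eq_fourier_neg F x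
  rw [h2]
  exact h.comp continuous_neg

theorem integral_fourierInv_mul_eq {F G : ℝ → ℂ} (hF : Integrable F) (hG : Integrable G) :
    ∫ x, 𝓕⁻ F x * G x = ∫ x, F x * 𝓕⁻ G x := by
  have h := VectorFourier.integral_fourierIntegral_smul_eq_flip (μ := volume) (ν := volume)
    (L := innerₗ ℝ) Real.continuous_fourierChar (by exact continuous_inner) hF hG.comp_neg
  have h1 : ∀ x, VectorFourier.fourierIntegral Real.fourierChar volume (innerₗ ℝ) F x = 𝓕 F x :=
    fun x => rfl
  have h2 : ∀ x, VectorFourier.fourierIntegral Real.fourierChar volume (innerₗ ℝ).flip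
      (fun t => G (-t)) x = 𝓕⁻ G x := by
    intro x
    rw [Real.fourierInv_eq_fourier_comp_neg, flip_innerₗ]
    rfl
  simp only [h1, h2, smul_eq_mul] at h
  rw [← h, ← integral_neg_eq_self (fun x => 𝓕⁻ F x * G x)]
  refine integral_congr_ae (Filter.Eventually.of_forall fun x => ?_)
  simp only [Real.fourierInv_eq_fourier_neg, neg_neg]

/-- On `L¹ ∩ L²` the inverse Fourier transform of `L²` is given by the inverse Fourier integral. -/
theorem coeFn_fourierInv_of_integrable (F : Lp ℂ 2 (volume : Measure ℝ))
    (hF : Integrable (F : ℝ → ℂ)) :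
    ((𝓕⁻ F : Lp ℂ 2 (volume : Measure ℝ)) : ℝ → ℂ) =ᵐ[volume] 𝓕⁻ (F : ℝ → ℂ) := by
  -- Test against smooth compactly supported `g`: the `L²` transform agrees with the distributional
  -- one, which acts on `g`, and the multiplication formula moves it back to `F`.
  refine ae_eq_of_integral_contDiff_smul_eq ((Lp.memLp _).locallyIntegrable (by norm_num))
    (continuous_fourierInv_of_integrable hF).locallyIntegrable fun g hg hgc => ?_
  have hg₁ : HasCompactSupport (Complex.ofRealCLM ∘ g) := hgc.comp_left rfl
  have hg₂ : ContDiff ℝ ((⊤ : ℕ∞) : WithTop ℕ∞) (Complex.ofRealCLM ∘ g) := by fun_prop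
  have key := congrArg (fun T => T (hg₁.toSchwartzMap hg₂))
    (Lp.fourierInv_toTemperedDistribution_eq F)
  simp only [TemperedDistribution.fourierInv_apply, Lp.toTemperedDistribution_apply] at key
  have e1 : ∫ x, g x • (𝓕⁻ F : Lp ℂ 2 (volume : Measure ℝ)) x =
      ∫ x, (hg₁.toSchwartzMap hg₂) x • (𝓕⁻ F : Lp ℂ 2 (volume : Measure ℝ)) x := by
    simp
  have e2 : ∫ x, g x • 𝓕⁻ (F : ℝ → ℂ) x =
      ∫ x, (hg₁.toSchwartzMap hg₂ : ℝ → ℂ) x * 𝓕⁻ (F : ℝ → ℂ) x := by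
    simp
  rw [e1, ← key, e2, ← integral_fourierInv_mul_eq (hg₁.toSchwartzMap hg₂).integrable hF,
    ← SchwartzMap.fourierInv_coe]
  rfl

/-- An `L²` function that vanishes outside `[-r, r]` is integrable. -/
theorem integrable_of_ae_eq_zero_off_Icc {F : ℝ → ℂ} (hF : MemLp F 2 volume) {r : ℝ}
    (hs : ∀ᵐ ξ : ℝ, ξ ∉ Set.Icc (-r) r → F ξ = 0) : Integrable F := by
  have h : IntegrableOn F (Set.Icc (-r) r) :=
    (hF.restrict _).integrable (by norm_num)
  rw [← integrable_indicator_iff measurableSet_Icc] at h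
  refine h.congr ?_
  filter_upwards [hs] with ξ hξ
  by_cases hm : ξ ∈ Set.Icc (-r) r
  · rw [Set.indicator_of_mem hm]
  · rw [Set.indicator_of_notMem hm, hξ hm]

/-- An integral of a function that vanishes outside `[-r, r]` is an interval integral. -/
theorem intervalIntegral_eq_of_ae_eq_zero_off_Icc {E : Type*} [NormedAddCommGroup E]
    [NormedSpace ℝ E] {F : ℝ → E} {r : ℝ} (hr : 0 < r)
    (hs : ∀ᵐ ξ : ℝ, ξ ∉ Set.Icc (-r) r → F ξ = 0) : ∫ ξ in (-r)..r, F ξ = ∫ ξ, F ξ := by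
  rw [intervalIntegral.integral_of_le (by linarith), ← integral_Icc_eq_integral_Ioc]
  exact setIntegral_eq_integral_of_ae_compl_eq_zero hs

theorem norm_sq_eq_integral_norm_sq (F : Lp ℂ 2 (volume : Measure ℝ)) :
    ‖F‖ ^ 2 = ∫ ξ, ‖F ξ‖ ^ 2 := by
  have h := congrArg RCLike.re (L2.inner_def (𝕜 := ℂ) F F)
  rw [← integral_re (L2.integrable_inner F F), ← norm_sq_eq_re_inner] at h
  rw [h]
  refine integral_congr_ae (Filter.Eventually.of_forall fun ξ => ?_)
  exact (norm_sq_eq_re_inner (𝕜 := ℂ) (F ξ)).symm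

/-- Parseval's identity for the samples, at spacing `1 / (2 r)`, of the inverse Fourier transform
of a function supported on `[-r, r]`. -/
theorem hasSum_norm_sq_fourierInv {r : ℝ} (hr : 0 < r) (F : Lp ℂ 2 (volume : Measure ℝ))
    (hs : ∀ᵐ ξ : ℝ, ξ ∉ Set.Icc (-r) r → F ξ = 0) :
    HasSum (fun n : ℤ => ‖𝓕⁻ (F : ℝ → ℂ) (n / (2 * r))‖ ^ 2) (2 * r * ‖F‖ ^ 2) := by
  have hab : -r < r := by linarith
  have h := hasSum_sq_fourierCoeffOn hab ((Lp.memLp F).restrict (Set.Ioc (-r) r))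
  -- The samples are `2r` times the Fourier coefficients of `F` on `[-r, r]`; the index is `-n`
  -- because the inverse transform has the kernel with positive exponent.
  have hc : ∀ n : ℤ, ‖𝓕⁻ (F : ℝ → ℂ) (n / (2 * r))‖ ^ 2 =
      (2 * r) ^ 2 * ‖fourierCoeffOn hab (F : ℝ → ℂ) (-n)‖ ^ 2 := by
    intro n
    rw [fourierCoeffOn_eq_integral, neg_neg, intervalIntegral_eq_of_ae_eq_zero_off_Icc hr,
      fourierInv_real_eq_integral_exp_mul, norm_smul, ← mul_pow, ← mul_assoc]
    · have : 2 * r * ‖1 / (r - -r)‖ = 1 := by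
        rw [Real.norm_of_nonneg (by apply one_div_nonneg.2; linarith)]
        field_simp
        ring
      rw [this, one_mul]
      congr 2
      refine integral_congr_ae (Filter.Eventually.of_forall fun ξ => ?_)
      simp only [smul_eq_mul, fourier_coe_apply]
      congr 2
      have : (r : ℂ) ≠ 0 := by exact_mod_cast hr.ne'
      push_cast
      rw [show (r : ℂ) - -r = 2 * r by ring]
      field_simp
    · filter_upwards [hs] with ξ hξ hm
      rw [hξ hm, smul_zero]
  have h3 := (((Equiv.neg ℤ).hasSum_iff.2 h).mul_left ((2 * r) ^ 2))
  rw [intervalIntegral_eq_of_ae_eq_zero_off_Icc hr, ← norm_sq_eq_integral_norm_sq, smul_eq_mul]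
    at h3
  · have he : (2 * r) ^ 2 * ((r - -r)⁻¹ * ‖F‖ ^ 2) = 2 * r * ‖F‖ ^ 2 := by
      rw [show r - -r = 2 * r by ring]
      field_simp
    rw [he] at h3
    rw [funext hc]
    exact h3
  · filter_upwards [hs] with ξ hξ hm
    simp [hξ hm]

/-- Polarization: if one of the two samples is zero at each point, then `|a + cb|² = |a|² + |b|²`
for every unimodular `c`, so Parseval gives Pythagoras for `F + cG`. Taking `c = 1` and `c = i`
kills the real and imaginary parts of the inner product. -/
theorem inner_eq_zero_of_fourierInv_eq_zero {r : ℝ} (hr : 0 < r)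
    (F G : Lp ℂ 2 (volume : Measure ℝ))
    (hF : ∀ᵐ ξ : ℝ, ξ ∉ Set.Icc (-r) r → F ξ = 0) (hG : ∀ᵐ ξ : ℝ, ξ ∉ Set.Icc (-r) r → G ξ = 0)
    (h : ∀ n : ℤ, 𝓕⁻ (F : ℝ → ℂ) (n / (2 * r)) = 0 ∨ 𝓕⁻ (G : ℝ → ℂ) (n / (2 * r)) = 0) :
    inner ℂ F G = 0 := by
  have hFi := integrable_of_ae_eq_zero_off_Icc (Lp.memLp F) hF
  have hGi := integrable_of_ae_eq_zero_off_Icc (Lp.memLp G) hG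
  have key : ∀ c : ℂ, ‖c‖ = 1 → ‖F + c • G‖ ^ 2 = ‖F‖ ^ 2 + ‖G‖ ^ 2 := by
    intro c hc
    have hae : ((F + c • G : Lp ℂ 2 (volume : Measure ℝ)) : ℝ → ℂ) =ᵐ[volume]
        fun ξ => F ξ + c * G ξ := by
      filter_upwards [Lp.coeFn_add F (c • G), Lp.coeFn_smul c G] with ξ h1 h2
      rw [h1, Pi.add_apply, h2, Pi.smul_apply, smul_eq_mul]
    have h1 := hasSum_norm_sq_fourierInv hr (F + c • G) (by
      filter_upwards [hF, hG, hae] with ξ h1 h2 h3 h4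
      rw [h3, h1 h4, h2 h4, mul_zero, add_zero])
    have h2 := (hasSum_norm_sq_fourierInv hr F hF).add (hasSum_norm_sq_fourierInv hr G hG)
    have h3 : ∀ x, 𝓕⁻ ((F + c • G : Lp ℂ 2 (volume : Measure ℝ)) : ℝ → ℂ) x =
        𝓕⁻ (F : ℝ → ℂ) x + c * 𝓕⁻ (G : ℝ → ℂ) x := by
      intro x
      rw [Real.fourierInv_congr_ae hae, fourierInv_real_eq_integral_exp_mul,
        fourierInv_real_eq_integral_exp_mul, fourierInv_real_eq_integral_exp_mul,
        ← integral_const_mul, ← integral_add (integrable_exp_mul hFi x)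
        ((integrable_exp_mul hGi x).const_mul c)]
      refine integral_congr_ae (Filter.Eventually.of_forall fun ξ => ?_)
      ring
    have h4 : 2 * r * ‖F + c • G‖ ^ 2 = 2 * r * (‖F‖ ^ 2 + ‖G‖ ^ 2) := by
      rw [mul_add]
      refine h1.unique ?_
      convert h2 using 2 with n
      rw [h3]
      rcases h n with h5 | h5 <;> simp [h5, hc]
    exact mul_left_cancel₀ (by positivity) h4
  have hre : ∀ c : ℂ, ‖c‖ = 1 → RCLike.re (inner ℂ F (c • G)) = 0 := by
    intro c hc
    have h1 := key c hc
    rw [norm_add_sq (𝕜 := ℂ), norm_smul, hc, one_mul] at h1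
    linarith
  have h1 := hre 1 (by simp)
  have h2 := hre Complex.I (by simp)
  rw [inner_smul_right] at h1 h2
  apply Complex.ext
  · simpa using h1
  · simpa using h2

end FourierL2

/-! ### Real functions and their spectra -/

section Complexification

theorem coeFn_complexify (u : L2R) :
    (complexify u : ℝ → ℂ) =ᵐ[volume] fun x => ((u x : ℝ) : ℂ) :=
  ContinuousLinearMap.coeFn_compLpL Complex.ofRealCLM u

theorem inner_complexify (u v : L2R) :
    inner ℂ (complexify u) (complexify v) = ((inner ℝ u v : ℝ) : ℂ) := by
  rw [L2.inner_def, L2.inner_def, ← integral_complex_ofReal]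
  refine integral_congr_ae ?_
  filter_upwards [coeFn_complexify u, coeFn_complexify v] with x h1 h2
  rw [h1, h2]
  simp

theorem norm_complexify (u : L2R) : ‖complexify u‖ = ‖u‖ := by
  have h := inner_complexify u u
  rw [inner_self_eq_norm_sq_to_K, real_inner_self_eq_norm_sq] at h
  have h' : ‖complexify u‖ ^ 2 = ‖u‖ ^ 2 := Complex.ofReal_injective (by rw [Complex.ofReal_pow]; exact h)
  exact (sq_eq_sq₀ (norm_nonneg _) (norm_nonneg _)).1 h'

/-- The Fourier transform of a real `L²` function. -/
def spectralFun : L2R →ₗ[ℝ] Lp ℂ 2 (volume : Measure ℝ) :=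
  ((Lp.fourierTransformₗᵢ ℝ ℂ).toLinearEquiv.toLinearMap.restrictScalars ℝ) ∘ₗ
    complexify.toLinearMap

theorem spectralFun_apply (u : L2R) : spectralFun u = 𝓕 (complexify u) := rfl

theorem fourierInv_spectralFun (u : L2R) :
    (𝓕⁻ (spectralFun u) : Lp ℂ 2 (volume : Measure ℝ)) = complexify u :=
  FourierTransform.fourierInv_fourier_eq _

theorem norm_spectralFun (u : L2R) : ‖spectralFun u‖ = ‖u‖ := by
  rw [spectralFun_apply, Lp.norm_fourier_eq, norm_complexify]

theorem inner_spectralFun (u v : L2R) :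
    inner ℂ (spectralFun u) (spectralFun v) = ((inner ℝ u v : ℝ) : ℂ) := by
  rw [spectralFun_apply, spectralFun_apply, Lp.inner_fourier_eq, inner_complexify]

theorem two_pi_mul_mem_Icc_iff (ξ : ℝ) :
    2 * Real.pi * ξ ∈ Set.Icc (-Real.pi) Real.pi ↔ ξ ∈ Set.Icc (-(1 / 2) : ℝ) (1 / 2) := by
  have hp := Real.pi_pos
  constructor
  · rintro ⟨h1, h2⟩
    constructor <;> nlinarith
  · rintro ⟨h1, h2⟩
    constructor <;> nlinarith

theorem mem_bandlimited_iff (u : L2R) :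
    u ∈ bandlimited ↔
      ∀ᵐ ξ : ℝ, ξ ∉ Set.Icc (-(1 / 2) : ℝ) (1 / 2) → (spectralFun u : ℝ → ℂ) ξ = 0 := by
  simp only [← two_pi_mul_mem_Icc_iff]
  rfl

theorem ae_eq_zero_off_Icc_mono {F : ℝ → ℂ} {r s : ℝ} (hrs : r ≤ s)
    (h : ∀ᵐ ξ : ℝ, ξ ∉ Set.Icc (-r) r → F ξ = 0) :
    ∀ᵐ ξ : ℝ, ξ ∉ Set.Icc (-s) s → F ξ = 0 := by
  filter_upwards [h] with ξ hξ hm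
  exact hξ fun h' => hm ⟨by linarith [h'.1], by linarith [h'.2]⟩

theorem integrable_spectralFun {u : L2R} (hu : u ∈ bandlimited) :
    Integrable (spectralFun u : ℝ → ℂ) :=
  integrable_of_ae_eq_zero_off_Icc (Lp.memLp _) ((mem_bandlimited_iff u).1 hu)

theorem coeFn_complexify_eq_fourierInv {u : L2R} (hu : u ∈ bandlimited) :
    (complexify u : ℝ → ℂ) =ᵐ[volume] 𝓕⁻ (spectralFun u : ℝ → ℂ) := by
  have h := coeFn_fourierInv_of_integrable _ (integrable_spectralFun hu)
  rwa [fourierInv_spectralFun] at h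

end Complexification

/-! ### The spectrum of `φ_n`, the frame and the orthonormal basis -/

section Spectrum

/-- The Fourier transform of `φ_n`. -/
def sincSpectrum (n : ℤ) : ℝ → ℂ :=
  Set.indicator (Set.Icc (-(1 / 2) : ℝ) (1 / 2))
    fun ξ => Complex.exp (-(2 * Real.pi * ξ * (n / 4) * Complex.I))

theorem memLp_sincSpectrum (n : ℤ) : MemLp (sincSpectrum n) 2 (volume : Measure ℝ) := by
  rw [sincSpectrum, memLp_indicator_iff_restrict measurableSet_Icc]
  refine MemLp.of_bound (by fun_prop) 1 (Filter.Eventually.of_forall fun ξ => ?_)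
  have h := Complex.norm_exp_ofReal_mul_I (-(2 * Real.pi * ξ * (n / 4)))
  push_cast at h
  rw [neg_mul] at h
  exact h.le

theorem integral_exp_eq_sinc (y : ℝ) :
    ∫ ξ in (-(1 / 2) : ℝ)..(1 / 2), Complex.exp (2 * Real.pi * ξ * y * Complex.I) =
      Real.sinc (Real.pi * y) := by
  by_cases hy : y = 0
  · subst hy
    simp
    norm_num
  have hp : Real.pi * y ≠ 0 := mul_ne_zero Real.pi_ne_zero hy
  have h := integral_exp_mul_I_eq_sinc (Real.pi * y)
  have h2 := intervalIntegral.smul_integral_comp_mul_left (a := -(1 / 2)) (b := 1 / 2)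
    (fun t : ℝ => Complex.exp (t * Complex.I)) (2 * (Real.pi * y))
  rw [show 2 * (Real.pi * y) * -(1 / 2) = -(Real.pi * y) by ring,
    show 2 * (Real.pi * y) * (1 / 2) = Real.pi * y by ring, h, Complex.real_smul] at h2
  push_cast at h2
  have hp' : (2 : ℂ) * (Real.pi * y) ≠ 0 := by exact_mod_cast mul_ne_zero two_ne_zero hp
  have h3 := mul_left_cancel₀ hp' h2
  rw [← h3]
  congr 1
  funext ξ
  congr 1
  ring

theorem fourierInv_sincSpectrum (n : ℤ) (x : ℝ) :
    𝓕⁻ (sincSpectrum n) x = (sincFun n x : ℂ) := by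
  rw [fourierInv_real_eq_integral_exp_mul, sincFun, ← integral_exp_eq_sinc,
    intervalIntegral.integral_of_le (by norm_num), ← integral_Icc_eq_integral_Ioc,
    ← integral_indicator measurableSet_Icc]
  congr 1
  funext ξ
  by_cases hm : ξ ∈ Set.Icc (-(1 / 2) : ℝ) (1 / 2)
  · rw [sincSpectrum, Set.indicator_of_mem hm, Set.indicator_of_mem hm, ← Complex.exp_add]
    congr 1
    push_cast
    ring
  · rw [sincSpectrum, Set.indicator_of_notMem hm, Set.indicator_of_notMem hm, mul_zero]

theorem coeFn_phi (n : ℤ) : (phi n : ℝ → ℝ) =ᵐ[volume] sincFun n :=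
  MemLp.coeFn_toLp _

theorem sincSpectrum_of_notMem (n : ℤ) {ξ : ℝ} (hξ : ξ ∉ Set.Icc (-(1 / 2) : ℝ) (1 / 2)) :
    sincSpectrum n ξ = 0 :=
  Set.indicator_of_notMem hξ _

/-- The sinc is not integrable, so the computation starts on the frequency side: the inverse
transform of the integrable `sincSpectrum n` is an explicit integral, and applying `𝓕` undoes it. -/
theorem spectralFun_phi (n : ℤ) :
    spectralFun (phi n) = (memLp_sincSpectrum n).toLp (sincSpectrum n) := by
  have hc := (memLp_sincSpectrum n).coeFn_toLp
  have hi : Integrable (sincSpectrum n) :=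
    integrable_of_ae_eq_zero_off_Icc (memLp_sincSpectrum n)
      (Filter.Eventually.of_forall fun ξ hξ => sincSpectrum_of_notMem n hξ)
  have h1 := coeFn_fourierInv_of_integrable _ (hi.congr hc.symm)
  have h2 : (𝓕⁻ ((memLp_sincSpectrum n).toLp (sincSpectrum n)) : Lp ℂ 2 (volume : Measure ℝ)) =
      complexify (phi n) := by
    apply Lp.ext
    filter_upwards [h1, coeFn_complexify (phi n), coeFn_phi n] with x e1 e2 e3
    rw [e1, e2, e3, Real.fourierInv_congr_ae hc, fourierInv_sincSpectrum]
  rw [spectralFun_apply, ← h2]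
  exact FourierTransform.fourier_fourierInv_eq _

theorem coeFn_spectralFun_phi (n : ℤ) :
    (spectralFun (phi n) : ℝ → ℂ) =ᵐ[volume] sincSpectrum n := by
  rw [spectralFun_phi]
  exact MemLp.coeFn_toLp _

theorem phi_mem_bandlimited (n : ℤ) : phi n ∈ bandlimited := by
  rw [mem_bandlimited_iff]
  filter_upwards [coeFn_spectralFun_phi n] with ξ h hm
  rw [h, sincSpectrum_of_notMem n hm]

/-- Inner products with `φ_n` are samples at `n / 4`. -/
theorem inner_phi_eq_fourierInv {u : L2R} (hu : u ∈ bandlimited) (n : ℤ) :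
    ((inner ℝ u (phi n) : ℝ) : ℂ) = 𝓕⁻ (spectralFun u : ℝ → ℂ) (n / 4) := by
  rw [real_inner_comm, ← inner_spectralFun, L2.inner_def, fourierInv_real_eq_integral_exp_mul]
  refine integral_congr_ae ?_
  filter_upwards [coeFn_spectralFun_phi n, (mem_bandlimited_iff u).1 hu] with ξ h1 h2
  by_cases hm : ξ ∈ Set.Icc (-(1 / 2) : ℝ) (1 / 2)
  · rw [h1, sincSpectrum, Set.indicator_of_mem hm, RCLike.inner_apply, ← Complex.exp_conj,
      mul_comm]
    congr 2
    simp only [map_neg, map_mul, map_div₀, Complex.conj_ofReal, Complex.conj_I, map_intCast,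
      map_ofNat]
    push_cast
    ring
  · rw [h2 hm, inner_zero_right, mul_zero]

theorem inner_phi_phi (k n : ℤ) : inner ℝ (phi k) (phi n) = sincFun k (n / 4) := by
  have h := inner_phi_eq_fourierInv (phi_mem_bandlimited k) n
  rw [Real.fourierInv_congr_ae (coeFn_spectralFun_phi k), fourierInv_sincSpectrum] at h
  exact_mod_cast h

/-- The case `r = 2`: sampling at spacing `1/4`, four times the critical density, whence the factor
4. -/
theorem hasSum_sq_inner_phi {u : L2R} (hu : u ∈ bandlimited) :
    HasSum (fun n : ℤ => |inner ℝ u (phi n)| ^ 2) (4 * ‖u‖ ^ 2) := by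
  have h := hasSum_norm_sq_fourierInv (r := 2) (by norm_num) (spectralFun u)
    (ae_eq_zero_off_Icc_mono (by norm_num) ((mem_bandlimited_iff u).1 hu))
  rw [norm_spectralFun] at h
  norm_num only at h
  convert h using 2 with n
  rw [← inner_phi_eq_fourierInv hu, Complex.norm_real, Real.norm_eq_abs]

theorem hasSum_sq_inner_phi_four_mul {u : L2R} (hu : u ∈ bandlimited) :
    HasSum (fun l : ℤ => |inner ℝ u (phi (4 * l))| ^ 2) (‖u‖ ^ 2) := by
  have h := hasSum_norm_sq_fourierInv (r := 1 / 2) (by norm_num) (spectralFun u)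
    ((mem_bandlimited_iff u).1 hu)
  rw [norm_spectralFun] at h
  norm_num only [one_mul] at h
  convert h using 2 with l
  rw [← Real.norm_eq_abs, ← Complex.norm_real, inner_phi_eq_fourierInv hu,
    show ((4 * l : ℤ) : ℝ) / 4 = l / 1 by push_cast; ring]

theorem isFrameFor_phi : IsFrameFor phi bandlimited := by
  refine ⟨phi_mem_bandlimited, 4, 4, by norm_num, le_rfl, fun u hu => ?_⟩
  have h := hasSum_sq_inner_phi hu
  exact ⟨h.summable, h.tsum_eq.ge, h.tsum_eq.le⟩

theorem sinc_pi_mul_int (k : ℤ) : Real.sinc (Real.pi * k) = if k = 0 then 1 else 0 := by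
  split_ifs with h
  · simp [h]
  · have : Real.pi * k ≠ 0 := mul_ne_zero Real.pi_ne_zero (by exact_mod_cast h)
    rw [Real.sinc_of_ne_zero this, mul_comm, Real.sin_int_mul_pi, zero_div]

theorem orthonormal_phi_four_mul : Orthonormal ℝ fun l : ℤ => phi (4 * l) := by
  rw [orthonormal_iff_ite]
  intro i j
  rw [inner_phi_phi, sincFun]
  have h := sinc_pi_mul_int (j - i)
  push_cast at h ⊢
  rw [show (4 * (j : ℝ) / 4 - 4 * i / 4) = j - i by ring, h]
  simp only [sub_eq_zero, eq_comm]

theorem isClosed_bandlimited : IsClosed (bandlimited : Set L2R) := by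
  have hS : MeasurableSet (Set.Icc (-(1 / 2) : ℝ) (1 / 2))ᶜ := measurableSet_Icc.compl
  let R := LpToLpRestrictCLM ℝ ℂ ℂ (volume : Measure ℝ) 2 (Set.Icc (-(1 / 2) : ℝ) (1 / 2))ᶜ
  have hc : Continuous fun u : L2R => R (spectralFun u) :=
    R.continuous.comp ((Lp.fourierTransformₗᵢ ℝ ℂ).continuous.comp complexify.continuous)
  have he : (bandlimited : Set L2R) = {u | R (spectralFun u) = 0} := by
    ext u
    rw [SetLike.mem_coe, mem_bandlimited_iff, Set.mem_ofPred_eq, Lp.eq_zero_iff_ae_eq_zero,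
      Filter.EventuallyEq, ← Filter.eventually_congr ((LpToLpRestrictCLM_coeFn ℂ _ _).mono
        fun ξ hξ => by rw [hξ]), ae_restrict_iff' hS]
    rfl
  rw [he]
  exact isClosed_eq hc continuous_const

/-- The residual of the projection onto the closed span is bandlimited and orthogonal to every
`φ_{4ℓ}`; by Parseval its norm is zero. -/
theorem topologicalClosure_span_phi_four_mul :
    (Submodule.span ℝ (Set.range fun l : ℤ => phi (4 * l))).topologicalClosure = bandlimited := by
  set K := (Submodule.span ℝ (Set.range fun l : ℤ => phi (4 * l))).topologicalClosure with hK
  have hle : K ≤ bandlimited := by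
    refine Submodule.topologicalClosure_minimal _ ?_ isClosed_bandlimited
    rw [Submodule.span_le]
    rintro _ ⟨l, rfl⟩
    exact phi_mem_bandlimited _
  refine le_antisymm hle fun u hu => ?_
  have : CompleteSpace K :=
    (Submodule.isClosed_topologicalClosure _).completeSpace_coe
  have hmem : u - K.starProjection u ∈ bandlimited :=
    bandlimited.sub_mem hu (hle (Submodule.starProjection_apply_mem _ _))
  have h := hasSum_sq_inner_phi_four_mul hmem
  have h0 : ∀ l : ℤ, |inner ℝ (u - K.starProjection u) (phi (4 * l))| ^ 2 = 0 := by
    intro l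
    have hl : phi (4 * l) ∈ K :=
      Submodule.le_topologicalClosure _ (Submodule.subset_span ⟨l, rfl⟩)
    rw [Submodule.starProjection_inner_eq_zero u _ hl]
    simp
  simp only [h0] at h
  have h1 := h.unique hasSum_zero
  have h2 : u - K.starProjection u = 0 := by simpa using h1
  rw [sub_eq_zero.1 h2]
  exact Submodule.starProjection_apply_mem _ _

theorem finrank_V (n : ℕ) : Module.finrank ℝ (V n) = 2 * n + 1 := by
  have hli : LinearIndependent ℝ fun l : Set.Icc (-(n : ℤ)) n => phi (4 * (l : ℤ)) :=
    orthonormal_phi_four_mul.linearIndependent.comp _ Subtype.val_injective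
  have h := finrank_span_eq_card hli
  have hr : Set.range (fun l : Set.Icc (-(n : ℤ)) n => phi (4 * (l : ℤ))) =
      (fun l : ℤ => phi (4 * l)) '' Set.Icc (-(n : ℤ)) n := by
    rw [Set.image_eq_range]
  rw [V, ← hr, h]
  simp
  omega

end Spectrum

/-! ### Phase retrieval by oversampling and analyticity -/

section PhaseRetrieval

/-- Translation of an `L²` function. -/
def translate (η : ℝ) (G : Lp ℂ 2 (volume : Measure ℝ)) : Lp ℂ 2 (volume : Measure ℝ) :=
  Lp.compMeasurePreserving (fun ξ => ξ + η) (measurePreserving_add_right volume η) G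

theorem coeFn_translate (η : ℝ) (G : Lp ℂ 2 (volume : Measure ℝ)) :
    (translate η G : ℝ → ℂ) =ᵐ[volume] fun ξ => G (ξ + η) :=
  Lp.coeFn_compMeasurePreserving G (measurePreserving_add_right volume η)

theorem fourierInv_translate (η : ℝ) (G : Lp ℂ 2 (volume : Measure ℝ)) (x : ℝ) :
    𝓕⁻ (translate η G : ℝ → ℂ) x =
      Complex.exp (-(2 * Real.pi * x * η * Complex.I)) * 𝓕⁻ (G : ℝ → ℂ) x := by
  rw [Real.fourierInv_congr_ae (coeFn_translate η G), fourierInv_real_eq_integral_exp_mul,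
    fourierInv_real_eq_integral_exp_mul, ← integral_const_mul,
    ← integral_add_right_eq_self (μ := (volume : Measure ℝ))
      (fun ξ : ℝ => Complex.exp (-(2 * Real.pi * x * η * Complex.I)) *
        (Complex.exp (2 * Real.pi * ξ * x * Complex.I) * G ξ)) η]
  refine integral_congr_ae (Filter.Eventually.of_forall fun ξ => ?_)
  simp only [← mul_assoc, ← Complex.exp_add]
  congr 2
  push_cast
  ring

theorem translate_eq_zero_of_notMem (η : ℝ) {G : Lp ℂ 2 (volume : Measure ℝ)} {r : ℝ}
    (hG : ∀ᵐ ξ : ℝ, ξ ∉ Set.Icc (-r) r → G ξ = 0) :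
    ∀ᵐ ξ : ℝ, ξ + η ∉ Set.Icc (-r) r → translate η G ξ = 0 := by
  have h := (measurePreserving_add_right volume η).quasiMeasurePreserving.ae hG
  filter_upwards [h, coeFn_translate η G] with ξ h1 h2 h3
  rw [h2, h1 h3]

/-- If at each point `n / 4` one of two bandlimited functions vanishes, then the Fourier transform
of the one is orthogonal to all translates of that of the other. -/
theorem inner_spectralFun_translate_eq_zero {u v : L2R} (hu : u ∈ bandlimited)
    (hv : v ∈ bandlimited) (h : ∀ n : ℤ, inner ℝ u (phi n) = 0 ∨ inner ℝ v (phi n) = 0) (η : ℝ) :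
    inner ℂ (spectralFun u) (translate η (spectralFun v)) = 0 := by
  have hF := (mem_bandlimited_iff u).1 hu
  have hG := translate_eq_zero_of_notMem η ((mem_bandlimited_iff v).1 hv)
  -- For `|η| ≤ 1` the translate still lives in `[-2, 2]`, where samples at spacing `1/4` determine
  -- inner products; otherwise the two supports are disjoint.
  by_cases hη : |η| ≤ 1
  · rw [abs_le] at hη
    refine inner_eq_zero_of_fourierInv_eq_zero (r := 2) (by norm_num) _ _
      (ae_eq_zero_off_Icc_mono (by norm_num) hF) ?_ fun n => ?_
    · filter_upwards [hG] with ξ hξ hm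
      refine hξ fun h' => hm ⟨?_, ?_⟩
      · linarith [h'.1]
      · linarith [h'.2]
    · rw [show (2 : ℝ) * 2 = 4 by norm_num, fourierInv_translate, ← inner_phi_eq_fourierInv hu,
        ← inner_phi_eq_fourierInv hv]
      rcases h n with h0 | h0
      · exact Or.inl (by rw [h0, Complex.ofReal_zero])
      · exact Or.inr (by rw [h0, Complex.ofReal_zero, mul_zero])
  · rw [L2.inner_def]
    refine integral_eq_zero_of_ae ?_
    filter_upwards [hF, hG] with ξ h1 h2
    by_cases hm : ξ ∈ Set.Icc (-(1 / 2) : ℝ) (1 / 2)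
    · rw [h2, inner_zero_right, Pi.zero_apply]
      intro hm'
      apply hη
      rw [abs_le]
      constructor
      · linarith [hm.2, hm'.1]
      · linarith [hm.1, hm'.2]
    · rw [h1 hm, inner_zero_left, Pi.zero_apply]

/-- By Plancherel, the Fourier transform of the product at `η` is the inner product of the spectrum
of `u` with the translate by `η` of that of `v`; `u` being real removes the conjugate. All these
vanish, and Fourier inversion for continuous integrable functions finishes. -/
theorem fourierInv_mul_fourierInv_eq_zero {u v : L2R} (hu : u ∈ bandlimited)
    (hv : v ∈ bandlimited) (h : ∀ n : ℤ, inner ℝ u (phi n) = 0 ∨ inner ℝ v (phi n) = 0) (x : ℝ) :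
    𝓕⁻ (spectralFun u : ℝ → ℂ) x * 𝓕⁻ (spectralFun v : ℝ → ℂ) x = 0 := by
  have hFi := integrable_spectralFun hu
  have hGi := integrable_spectralFun hv
  set a : ℝ → ℂ := 𝓕⁻ (spectralFun u : ℝ → ℂ) with ha
  set b : ℝ → ℂ := 𝓕⁻ (spectralFun v : ℝ → ℂ) with hb
  have hac : (complexify u : ℝ → ℂ) =ᵐ[volume] a := coeFn_complexify_eq_fourierInv hu
  have hbc : (complexify v : ℝ → ℂ) =ᵐ[volume] b := coeFn_complexify_eq_fourierInv hv
  have hcont : Continuous fun x => a x * b x :=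
    (continuous_fourierInv_of_integrable hFi).mul (continuous_fourierInv_of_integrable hGi)
  have hint : Integrable fun x => a x * b x :=
    ((Lp.memLp (complexify u)).ae_eq hac).integrable_mul ((Lp.memLp (complexify v)).ae_eq hbc)
  have hzero : 𝓕 (fun x => a x * b x) = 0 := by
    funext η
    have hTi : Integrable (translate η (spectralFun v) : ℝ → ℂ) :=
      (hGi.comp_add_right η).congr (coeFn_translate η _).symm
    have h1 := inner_spectralFun_translate_eq_zero hu hv h η
    have h2 : translate η (spectralFun v) =
        𝓕 (𝓕⁻ (translate η (spectralFun v)) : Lp ℂ 2 (volume : Measure ℝ)) :=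
      (FourierTransform.fourier_fourierInv_eq _).symm
    rw [h2, spectralFun_apply, Lp.inner_fourier_eq, L2.inner_def] at h1
    rw [Pi.zero_apply, ← h1, Real.fourier_real_eq_integral_exp_smul]
    refine integral_congr_ae ?_
    filter_upwards [hac, coeFn_complexify u, coeFn_fourierInv_of_integrable _ hTi] with x e1 e2 e3
    rw [e3, fourierInv_translate, RCLike.inner_apply, ← e1, e2, Complex.conj_ofReal, smul_eq_mul]
    rw [show ((-2 * Real.pi * x * η : ℝ) : ℂ) * Complex.I =
      -(2 * Real.pi * x * η * Complex.I) by push_cast; ring]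
    ring
  have hinv := hcont.fourierInv_fourier_eq hint (by rw [hzero]; exact integrable_zero _ _ _)
  rw [hzero] at hinv
  have := congrFun hinv x
  rw [fourierInv_real_eq_integral_exp_mul] at this
  simpa using this.symm

/-- The inverse Fourier transform of an integrable function with bounded support extends to an
entire function. -/
theorem differentiable_integral_exp_mul {F : ℝ → ℂ} (hF : Integrable F) {r : ℝ}
    (hs : ∀ᵐ ξ : ℝ, ξ ∉ Set.Icc (-r) r → F ξ = 0) :
    Differentiable ℂ fun z : ℂ => ∫ ξ : ℝ, Complex.exp (2 * Real.pi * ξ * z * Complex.I) * F ξ := by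
  intro z₀
  set M : ℝ := Real.exp (2 * Real.pi * |r| * (‖z₀‖ + 1)) with hM
  have hexp : ∀ ξ ∈ Set.Icc (-r) r, ∀ z ∈ Metric.ball z₀ 1,
      ‖Complex.exp (2 * Real.pi * ξ * z * Complex.I)‖ ≤ M := by
    intro ξ hξ z hz
    have hz' : ‖z‖ ≤ ‖z₀‖ + 1 := by
      have := norm_sub_norm_le z z₀
      have h2 := mem_ball_iff_norm.1 hz
      linarith
    have hξ' : |ξ| ≤ |r| := abs_le_abs hξ.2 (by linarith [hξ.1])
    refine (Complex.norm_exp_le_exp_norm _).trans (Real.exp_le_exp.2 ?_)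
    simp only [norm_mul, Complex.norm_real, Complex.norm_I, mul_one, Complex.norm_ofNat,
      Real.norm_eq_abs, abs_of_pos Real.pi_pos]
    gcongr
  have hmeas : ∀ z : ℂ, AEStronglyMeasurable
      (fun ξ : ℝ => Complex.exp (2 * Real.pi * ξ * z * Complex.I) * F ξ) volume := fun z =>
    (by fun_prop : Continuous fun ξ : ℝ =>
      Complex.exp (2 * Real.pi * ξ * z * Complex.I)).aestronglyMeasurable.mul hF.1
  refine (hasDerivAt_integral_of_dominated_loc_of_deriv_le
    (F := fun (z : ℂ) (ξ : ℝ) => Complex.exp (2 * Real.pi * ξ * z * Complex.I) * F ξ)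
    (F' := fun (z : ℂ) (ξ : ℝ) =>
      Complex.exp (2 * Real.pi * ξ * z * Complex.I) * (2 * Real.pi * ξ * Complex.I) * F ξ)
    (bound := fun ξ => M * (2 * Real.pi * |r|) * ‖F ξ‖)
    (Metric.ball_mem_nhds z₀ one_pos) (Filter.Eventually.of_forall hmeas) ?_ ?_ ?_
    (hF.norm.const_mul _) ?_).2.differentiableAt
  · refine (hF.norm.const_mul M).mono' (hmeas z₀) ?_
    filter_upwards [hs] with ξ hξ
    by_cases hm : ξ ∈ Set.Icc (-r) r
    · rw [norm_mul]
      gcongr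
      exact hexp ξ hm z₀ (Metric.mem_ball_self one_pos)
    · simp [hξ hm]
  · exact (by fun_prop : Continuous fun ξ : ℝ => Complex.exp (2 * Real.pi * ξ * z₀ * Complex.I) *
      (2 * Real.pi * ξ * Complex.I)).aestronglyMeasurable.mul hF.1
  · filter_upwards [hs] with ξ hξ z hz
    by_cases hm : ξ ∈ Set.Icc (-r) r
    · have hξ' : |ξ| ≤ |r| := abs_le_abs hm.2 (by linarith [hm.1])
      rw [norm_mul, norm_mul]
      have h2 : ‖(2 * Real.pi * ξ * Complex.I : ℂ)‖ ≤ 2 * Real.pi * |r| := by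
        simp only [norm_mul, Complex.norm_real, Complex.norm_I, mul_one, Complex.norm_ofNat,
          Real.norm_eq_abs, abs_of_pos Real.pi_pos]
        gcongr
      gcongr
      exact hexp ξ hm z hz
    · simp [hξ hm]
  · refine Filter.Eventually.of_forall fun ξ z _ => ?_
    have h1 : HasDerivAt (fun z : ℂ => 2 * Real.pi * ξ * z * Complex.I)
        (2 * Real.pi * ξ * Complex.I) z := by
      have := ((hasDerivAt_id z).const_mul (2 * Real.pi * ξ : ℂ)).mul_const Complex.I
      simpa using this
    exact h1.cexp.mul_const (F ξ)

theorem analyticOnNhd_fourierInv {F : ℝ → ℂ} (hF : Integrable F) {r : ℝ}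
    (hs : ∀ᵐ ξ : ℝ, ξ ∉ Set.Icc (-r) r → F ξ = 0) : AnalyticOnNhd ℝ (𝓕⁻ F) Set.univ := by
  have h := differentiable_integral_exp_mul hF hs
  intro x _
  have h1 := (h.analyticAt (x : ℂ)).restrictScalars (𝕜 := ℝ)
  have h2 := h1.comp (f := fun x : ℝ => (x : ℂ)) (Complex.ofRealCLM.analyticAt x)
  exact h2.congr (Filter.Eventually.of_forall fun y =>
    (fourierInv_real_eq_integral_exp_mul F y).symm)

theorem eq_zero_of_fourierInv_eq_zero {u : L2R} (hu : u ∈ bandlimited)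
    (h : ∀ x, 𝓕⁻ (spectralFun u : ℝ → ℂ) x = 0) : u = 0 := by
  have h1 : complexify u = 0 := by
    rw [Lp.eq_zero_iff_ae_eq_zero]
    filter_upwards [coeFn_complexify_eq_fourierInv hu] with x hx
    rw [hx, h x, Pi.zero_apply]
  rw [← norm_eq_zero, ← norm_complexify, h1, norm_zero]

/-- Equal absolute values mean that `u - v` or `u + v` vanishes at each sample; analytic functions
on the connected line have no zero divisors. -/
theorem doesPhaseRetrieval_phi : DoesPhaseRetrieval phi bandlimited := by
  intro u hu v hv h
  have hs := bandlimited.sub_mem hu hv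
  have ha := bandlimited.add_mem hu hv
  have h0 : ∀ n : ℤ, inner ℝ (u - v) (phi n) = 0 ∨ inner ℝ (u + v) (phi n) = 0 := by
    intro n
    rw [inner_sub_left, inner_add_left, sub_eq_zero, add_eq_zero_iff_eq_neg]
    exact abs_eq_abs.1 (congrFun h n)
  have hmul := fourierInv_mul_fourierInv_eq_zero hs ha h0
  rcases (analyticOnNhd_fourierInv (integrable_spectralFun hs)
      ((mem_bandlimited_iff _).1 hs)).eq_zero_or_eq_zero_of_mul_eq_zero
      (analyticOnNhd_fourierInv (integrable_spectralFun ha) ((mem_bandlimited_iff _).1 ha))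
      (fun x _ => hmul x) isPreconnected_univ with h1 | h1
  · refine ⟨1, by simp, ?_⟩
    have := eq_zero_of_fourierInv_eq_zero hs fun x => h1 x (Set.mem_univ x)
    rw [one_smul, sub_eq_zero.1 this]
  · refine ⟨-1, by simp, ?_⟩
    have := eq_zero_of_fourierInv_eq_zero ha fun x => h1 x (Set.mem_univ x)
    rw [neg_one_smul, eq_neg_of_add_eq_zero_left this]

end PhaseRetrieval

/-! ### Binomial sums of sincs as finite differences -/

section BinomialSinc

/-- `∑_{ℓ=0}^m (m choose ℓ) sinc (π (y - ℓ))`. -/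
def binomialSinc (m : ℕ) (y : ℝ) : ℝ :=
  ∑ l ∈ Finset.range (m + 1), (m.choose l : ℝ) * Real.sinc (Real.pi * (y - l))

theorem binomialSinc_zero (y : ℝ) : binomialSinc 0 y = Real.sinc (Real.pi * y) := by
  simp [binomialSinc]

theorem binomialSinc_succ (m : ℕ) (y : ℝ) :
    binomialSinc (m + 1) y = binomialSinc m y + binomialSinc m (y - 1) := by
  unfold binomialSinc
  have h : ∀ l ∈ Finset.range (m + 1),
      ((m + 1).choose (l + 1) : ℝ) * Real.sinc (Real.pi * (y - (l + 1 : ℕ))) =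
        (m.choose l : ℝ) * Real.sinc (Real.pi * (y - 1 - l)) +
        (m.choose (l + 1) : ℝ) * Real.sinc (Real.pi * (y - (l + 1 : ℕ))) := by
    intro l _
    rw [Nat.choose_succ_succ]
    push_cast
    rw [show y - 1 - (l : ℝ) = y - (l + 1) by ring]
    ring
  have e : ∑ l ∈ Finset.range (m + 1),
      (m.choose (l + 1) : ℝ) * Real.sinc (Real.pi * (y - (l + 1 : ℕ))) +
        (m.choose 0 : ℝ) * Real.sinc (Real.pi * (y - (0 : ℕ))) =
      ∑ l ∈ Finset.range (m + 1), (m.choose l : ℝ) * Real.sinc (Real.pi * (y - l)) := by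
    rw [← Finset.sum_range_succ' fun l => (m.choose l : ℝ) * Real.sinc (Real.pi * (y - l)),
      Finset.sum_range_succ]
    simp
  rw [Finset.sum_range_succ', Finset.sum_congr rfl h, Finset.sum_add_distrib, ← e,
    Nat.choose_zero_right, Nat.choose_zero_right]
  ring

theorem prod_range_sub_succ (m : ℕ) (y : ℝ) :
    ∏ l ∈ Finset.range (m + 1), (y - l) = y * ∏ l ∈ Finset.range m, (y - 1 - l) := by
  rw [Finset.prod_range_succ', mul_comm]
  congr 1
  · simp
  · refine Finset.prod_congr rfl fun l _ => ?_
    push_cast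
    ring

theorem mul_sinc (y : ℝ) : y * Real.sinc y = Real.sin y := by
  by_cases hy : y = 0
  · simp [hy]
  · rw [Real.sinc_of_ne_zero hy, mul_div_cancel₀ _ hy]

/-- The binomial sum is a finite difference of `1 / y` times `sin (π y) / π`. -/
theorem prod_mul_binomialSinc (m : ℕ) (y : ℝ) :
    (∏ l ∈ Finset.range (m + 1), (y - l)) * (Real.pi * binomialSinc m y) =
      (-1) ^ m * m.factorial * Real.sin (Real.pi * y) := by
  induction m generalizing y with
  | zero =>
    rw [binomialSinc_zero, ← mul_sinc (Real.pi * y)]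
    simp
    ring
  | succ m ih =>
    have h1 := ih y
    have h2 := ih (y - 1)
    rw [mul_sub, mul_one, Real.sin_sub_pi] at h2
    have e1 : ∏ l ∈ Finset.range (m + 1 + 1), (y - l) =
        (y - (m + 1)) * ∏ l ∈ Finset.range (m + 1), (y - l) := by
      rw [Finset.prod_range_succ, mul_comm]
      push_cast
      rfl
    have e2 := prod_range_sub_succ (m + 1) y
    -- The last factor `y - (m + 1)` is split off for the first term and the first factor `y` for
    -- the shifted one. As `sin π(y - 1) = -sin πy`, the coefficients combine to `(y - (m + 1)) - y
    -- = -(m + 1)`.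
    calc (∏ l ∈ Finset.range (m + 1 + 1), (y - l)) * (Real.pi * binomialSinc (m + 1) y)
        = (∏ l ∈ Finset.range (m + 1 + 1), (y - l)) * (Real.pi * binomialSinc m y) +
          (∏ l ∈ Finset.range (m + 1 + 1), (y - l)) * (Real.pi * binomialSinc m (y - 1)) := by
          rw [binomialSinc_succ]
          ring
      _ = (y - (m + 1)) *
            ((∏ l ∈ Finset.range (m + 1), (y - l)) * (Real.pi * binomialSinc m y)) +
          y * ((∏ l ∈ Finset.range (m + 1), (y - 1 - l)) *
            (Real.pi * binomialSinc m (y - 1))) := by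
          nth_rw 1 [e1]
          rw [e2]
          ring
      _ = (-1) ^ (m + 1) * (m + 1).factorial * Real.sin (Real.pi * y) := by
          rw [h1, h2, Nat.factorial_succ]
          push_cast
          ring

theorem abs_binomialSinc_le_two_pow (m : ℕ) (y : ℝ) : |binomialSinc m y| ≤ 2 ^ m := by
  refine (Finset.abs_sum_le_sum_abs _ _).trans ?_
  have h : ((∑ l ∈ Finset.range (m + 1), m.choose l : ℕ) : ℝ) = 2 ^ m := by
    rw [Nat.sum_range_choose]
    push_cast
    rfl
  rw [← h, Nat.cast_sum]
  refine Finset.sum_le_sum fun l _ => ?_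
  rw [abs_mul, Nat.abs_cast]
  exact mul_le_of_le_one_right (Nat.cast_nonneg _) (Real.abs_sinc_le_one _)

theorem abs_prod_mul_binomialSinc_le (m : ℕ) (y : ℝ) :
    |∏ l ∈ Finset.range (m + 1), (y - l)| * |binomialSinc m y| ≤ m.factorial := by
  have h := congrArg abs (prod_mul_binomialSinc m y)
  simp only [abs_mul, abs_pow, abs_neg, abs_one, one_pow, one_mul, Nat.abs_cast,
    abs_of_pos Real.pi_pos] at h
  have hs := mul_le_of_le_one_right (Nat.cast_nonneg (α := ℝ) m.factorial)
    (Real.abs_sin_le_one (Real.pi * y))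
  have hp : 1 ≤ Real.pi := by linarith [Real.pi_gt_three]
  have h0 : 0 ≤ |∏ l ∈ Finset.range (m + 1), (y - l)| * |binomialSinc m y| := by positivity
  nlinarith

/-- `binomialSinc m` decays like `|x|^{-(m+1)}`. -/
theorem exists_abs_binomialSinc_le (m : ℕ) :
    ∃ K : ℝ, ∀ x : ℝ, |binomialSinc m (x + 2 * m)| ≤ K * ((1 + |x|) ^ (m + 1))⁻¹ := by
  -- The first summand serves `|x| ≥ 4m + 1`, where every factor of the product is at least `(1 +
  -- |x|) / 4`; the second serves smaller `|x|`, with the trivial bound `2 ^ m`.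
  refine ⟨m.factorial * 4 ^ (m + 1) + 2 ^ m * (4 * m + 2) ^ (m + 1), fun x => ?_⟩
  rw [← div_eq_mul_inv, le_div_iff₀ (by positivity)]
  by_cases hx : 4 * (m : ℝ) + 1 ≤ |x|
  · have hprod : ((1 + |x|) / 4) ^ (m + 1) ≤ |∏ l ∈ Finset.range (m + 1), (x + 2 * m - l)| := by
      rw [Finset.abs_prod, ← Finset.card_range (m + 1), ← Finset.prod_const, Finset.card_range]
      refine Finset.prod_le_prod (fun _ _ => by positivity) fun l hl => ?_
      have hl' : (l : ℝ) ≤ m := by exact_mod_cast Nat.lt_succ_iff.1 (Finset.mem_range.1 hl)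
      have hl0 : (0 : ℝ) ≤ l := Nat.cast_nonneg l
      have h1 : |x| ≤ |x + 2 * m - l| + |2 * m - (l : ℝ)| := by
        have := abs_sub (x + 2 * m - l) (2 * m - l)
        rwa [show x + 2 * m - l - (2 * m - l) = x by ring] at this
      rw [abs_of_nonneg (by linarith : (0 : ℝ) ≤ 2 * m - l)] at h1
      linarith
    have h2 := abs_prod_mul_binomialSinc_le m (x + 2 * m)
    have h3 : ((1 + |x|) / 4) ^ (m + 1) * |binomialSinc m (x + 2 * m)| ≤ m.factorial :=
      (mul_le_mul_of_nonneg_right hprod (abs_nonneg _)).trans h2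
    rw [div_pow, div_mul_eq_mul_div, div_le_iff₀ (by positivity)] at h3
    have h4 : (0 : ℝ) ≤ 2 ^ m * (4 * m + 2) ^ (m + 1) := by positivity
    linarith [mul_comm (|binomialSinc m (x + 2 * m)|) ((1 + |x|) ^ (m + 1))]
  · have h1 : (1 + |x|) ^ (m + 1) ≤ (4 * (m : ℝ) + 2) ^ (m + 1) :=
      pow_le_pow_left₀ (by positivity) (by linarith [not_le.1 hx]) _
    have h2 := mul_le_mul (abs_binomialSinc_le_two_pow m (x + 2 * m)) h1 (by positivity)
      (by positivity)
    have h3 : (0 : ℝ) ≤ m.factorial * 4 ^ (m + 1) := by positivity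
    linarith

/-- The tail bound that makes the two halves of `f_m` almost disjoint. -/
theorem centralBinom_mul_abs_binomialSinc_le (m : ℕ) {x : ℝ} (hx : 0 ≤ x) :
    m.centralBinom * |binomialSinc m (x + 2 * m)| ≤ |Real.sinc (Real.pi * (x + m))| := by
  rcases Nat.eq_zero_or_pos m with rfl | hm
  · simp [binomialSinc_zero]
  have hm' : (0 : ℝ) < m := by exact_mod_cast hm
  have h := congrArg abs (prod_mul_binomialSinc m (x + 2 * m))
  -- The factor `ℓ = m`, equal to `x + m`, is set aside to turn the sine into `sinc (π (x + m))`.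
  rw [Finset.prod_range_succ] at h
  have hs : |Real.sin (Real.pi * (x + 2 * m))| =
      Real.pi * (x + m) * |Real.sinc (Real.pi * (x + m))| := by
    have h1 : Real.pi * (x + 2 * m) = Real.pi * (x + m) + m * Real.pi := by ring
    have h0 : 0 ≤ Real.pi * (x + m) := by positivity
    rw [h1, Real.sin_add_nat_mul_pi, abs_mul, abs_pow, abs_neg, abs_one, one_pow, one_mul,
      ← mul_sinc, abs_mul, abs_of_nonneg h0]
  simp only [abs_mul, abs_pow, abs_neg, abs_one, one_pow, one_mul, Nat.abs_cast,
    abs_of_pos Real.pi_pos, hs] at h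
  rw [show x + 2 * m - (m : ℝ) = x + m by ring, abs_of_pos (by positivity : 0 < x + m)] at h
  have h2 : |∏ l ∈ Finset.range m, (x + 2 * m - l)| * |binomialSinc m (x + 2 * m)| =
      m.factorial * |Real.sinc (Real.pi * (x + m))| := by
    have hne : Real.pi * (x + m) ≠ 0 := by positivity
    apply mul_left_cancel₀ hne
    linear_combination h
  -- The left side is `2m (2m - 1) ⋯ (m + 1)`, the value of the product at `x = 0`.
  have h3 : (m.factorial : ℝ) * m.centralBinom ≤ |∏ l ∈ Finset.range m, (x + 2 * m - l)| := by
    rw [Nat.centralBinom_eq_two_mul_choose, ← Nat.cast_mul,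
      ← Nat.descFactorial_eq_factorial_mul_choose, Nat.descFactorial_eq_prod_range,
      Finset.abs_prod, Nat.cast_prod]
    refine Finset.prod_le_prod (fun _ _ => Nat.cast_nonneg _) fun l hl => ?_
    have hl' : l < m := Finset.mem_range.1 hl
    rw [Nat.cast_sub (by omega)]
    push_cast
    exact le_trans (by linarith) (le_abs_self _)
  have hf : (0 : ℝ) < m.factorial := by exact_mod_cast m.factorial_pos
  refine le_of_mul_le_mul_left ?_ hf
  rw [← h2, ← mul_assoc]
  exact mul_le_mul_of_nonneg_right h3 (abs_nonneg _)

/-- The induction proves the sharper bound with `m` in place of `m + 1`, for `m ≥ 1`; its step is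
`4m(m + 1) ≤ (2m + 1)²`. The stated form would not pass through the induction. -/
theorem sixteen_pow_le (m : ℕ) : (16 : ℝ) ^ m ≤ 4 * (m + 1) * (m.centralBinom : ℝ) ^ 2 := by
  have key : ∀ m : ℕ, (16 : ℝ) ^ (m + 1) ≤ 4 * (m + 1) * ((m + 1).centralBinom : ℝ) ^ 2 := by
    intro m
    induction m with
    | zero => norm_num [Nat.centralBinom, Nat.choose]
    | succ m ih =>
      have h : ((m : ℝ) + 1 + 1) * ((m + 1 + 1).centralBinom : ℝ) =
          2 * (2 * (m + 1) + 1) * ((m + 1).centralBinom : ℝ) := by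
        exact_mod_cast Nat.succ_mul_centralBinom_succ (m + 1)
      have hm : (0 : ℝ) < (m : ℝ) + 1 + 1 := by positivity
      refine le_of_mul_le_mul_left ?_ hm
      have e : ((m : ℝ) + 1 + 1) * (4 * ((m + 1 : ℕ) + 1) * ((m + 1 + 1).centralBinom : ℝ) ^ 2) =
          4 * (2 * (2 * (m + 1) + 1) * ((m + 1).centralBinom : ℝ)) ^ 2 := by
        rw [← h]
        push_cast
        ring
      rw [e, pow_succ]
      have h1 : ((m : ℝ) + 1 + 1) * (16 ^ (m + 1) * 16) ≤
          ((m : ℝ) + 1 + 1) * (4 * (m + 1) * ((m + 1).centralBinom : ℝ) ^ 2 * 16) := by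
        gcongr
      refine h1.trans ?_
      nlinarith [sq_nonneg ((m + 1).centralBinom : ℝ)]
  cases m with
  | zero => norm_num
  | succ m =>
    refine (key m).trans ?_
    gcongr
    linarith

end BinomialSinc

/-! ### Large distance, small amplitude difference -/

section Stability

/-- The left half `∑ (m choose ℓ) φ_{4(-2m+ℓ)}` of `f_m`. -/
def leftBump (m : ℕ) : L2R :=
  ∑ l ∈ Finset.range (m + 1), (m.choose l : ℝ) • phi (4 * (-2 * (m : ℤ) + l))

/-- The right half `∑ (m choose ℓ) φ_{4(2m-ℓ)}` of `f_m`. -/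
def rightBump (m : ℕ) : L2R :=
  ∑ l ∈ Finset.range (m + 1), (m.choose l : ℝ) • phi (4 * (2 * (m : ℤ) - l))

theorem f_eq (m : ℕ) : f m = leftBump m + rightBump m := by
  simp only [f, leftBump, rightBump, smul_add, Finset.sum_add_distrib]

theorem g_eq (m : ℕ) : g m = leftBump m - rightBump m := by
  simp only [g, leftBump, rightBump, smul_sub, Finset.sum_sub_distrib]

theorem sum_choose_mul_sincFun_left (m : ℕ) (x : ℝ) :
    ∑ l ∈ Finset.range (m + 1), (m.choose l : ℝ) * sincFun (4 * (-2 * (m : ℤ) + l)) x =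
      binomialSinc m (x + 2 * m) := by
  refine Finset.sum_congr rfl fun l _ => ?_
  rw [sincFun]
  congr 3
  push_cast
  ring

theorem sum_choose_mul_sincFun_right (m : ℕ) (x : ℝ) :
    ∑ l ∈ Finset.range (m + 1), (m.choose l : ℝ) * sincFun (4 * (2 * (m : ℤ) - l)) x =
      binomialSinc m (-x + 2 * m) := by
  refine Finset.sum_congr rfl fun l _ => ?_
  rw [sincFun, ← Real.sinc_neg]
  congr 2
  push_cast
  ring

theorem coeFn_sum_smul_phi (m : ℕ) (k : ℕ → ℤ) :
    ((∑ l ∈ Finset.range (m + 1), (m.choose l : ℝ) • phi (k l) : L2R) : ℝ → ℝ) =ᵐ[volume]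
      fun x => ∑ l ∈ Finset.range (m + 1), (m.choose l : ℝ) * sincFun (k l) x := by
  have h1 : ∀ᵐ x : ℝ, ∀ l : ℕ, ((m.choose l : ℝ) • phi (k l) : L2R) x =
      (m.choose l : ℝ) * sincFun (k l) x := by
    rw [ae_all_iff]
    intro l
    filter_upwards [Lp.coeFn_smul (m.choose l : ℝ) (phi (k l)), coeFn_phi (k l)] with x e1 e2
    rw [e1, Pi.smul_apply, e2, smul_eq_mul]
  have h2 := Lp.coeFn_finsetSum (Finset.range (m + 1))
    fun l => ((m.choose l : ℝ) • phi (k l) : L2R)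
  filter_upwards [h1, h2] with x e1 e2
  rw [e2]
  simp only [Finset.sum_apply, e1]

theorem coeFn_leftBump (m : ℕ) :
    (leftBump m : ℝ → ℝ) =ᵐ[volume] fun x => binomialSinc m (x + 2 * m) := by
  filter_upwards [coeFn_sum_smul_phi m fun l => 4 * (-2 * (m : ℤ) + l)] with x hx
  rw [leftBump, hx, sum_choose_mul_sincFun_left]

theorem coeFn_rightBump (m : ℕ) :
    (rightBump m : ℝ → ℝ) =ᵐ[volume] fun x => binomialSinc m (-x + 2 * m) := by
  filter_upwards [coeFn_sum_smul_phi m fun l => 4 * (2 * (m : ℤ) - l)] with x hx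
  rw [rightBump, hx, sum_choose_mul_sincFun_right]

theorem inner_leftBump_phi (m : ℕ) (n : ℤ) :
    inner ℝ (leftBump m) (phi n) = binomialSinc m (n / 4 + 2 * m) := by
  rw [leftBump, sum_inner, ← sum_choose_mul_sincFun_left]
  refine Finset.sum_congr rfl fun l _ => ?_
  rw [real_inner_smul_left, inner_phi_phi]

theorem inner_rightBump_phi (m : ℕ) (n : ℤ) :
    inner ℝ (rightBump m) (phi n) = binomialSinc m (-(n / 4) + 2 * m) := by
  rw [rightBump, sum_inner, ← sum_choose_mul_sincFun_right]
  refine Finset.sum_congr rfl fun l _ => ?_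
  rw [real_inner_smul_left, inner_phi_phi]

/-- Vandermonde: the squares of the binomial coefficients sum to the central one. -/
theorem norm_sq_sum_choose_smul {ι : Type*} {e : ι → L2R} (he : Orthonormal ℝ e) (m : ℕ)
    (k : ℕ → ι) (hk : Function.Injective k) :
    ‖∑ l ∈ Finset.range (m + 1), (m.choose l : ℝ) • e (k l)‖ ^ 2 = m.centralBinom := by
  have h := (he.comp k hk).inner_sum (fun l => (m.choose l : ℝ)) (fun l => (m.choose l : ℝ))
    (Finset.range (m + 1))
  rw [real_inner_self_eq_norm_sq] at h
  simp only [Function.comp_apply] at h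
  rw [h, Nat.centralBinom_eq_two_mul_choose, ← Nat.sum_range_choose_sq]
  push_cast
  refine Finset.sum_congr rfl fun l _ => ?_
  simp [sq]

theorem norm_sq_leftBump (m : ℕ) : ‖leftBump m‖ ^ 2 = m.centralBinom :=
  norm_sq_sum_choose_smul orthonormal_phi_four_mul m (fun l : ℕ => -2 * (m : ℤ) + l)
    fun a b h => by simpa using h

theorem norm_sq_rightBump (m : ℕ) : ‖rightBump m‖ ^ 2 = m.centralBinom :=
  norm_sq_sum_choose_smul orthonormal_phi_four_mul m (fun l : ℕ => 2 * (m : ℤ) - l)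
    fun a b h => by simpa using h

theorem phi_mem_V {n : ℕ} {l : ℤ} (h1 : -(n : ℤ) ≤ l) (h2 : l ≤ n) : phi (4 * l) ∈ V n :=
  Submodule.subset_span ⟨l, ⟨h1, h2⟩, rfl⟩

theorem leftBump_mem_V (m : ℕ) : leftBump m ∈ V (2 * m) := by
  refine Submodule.sum_mem _ fun l hl => Submodule.smul_mem _ _ (phi_mem_V ?_ ?_)
  all_goals
    have := Finset.mem_range.1 hl
    push_cast
    omega

theorem rightBump_mem_V (m : ℕ) : rightBump m ∈ V (2 * m) := by
  refine Submodule.sum_mem _ fun l hl => Submodule.smul_mem _ _ (phi_mem_V ?_ ?_)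
  all_goals
    have := Finset.mem_range.1 hl
    push_cast
    omega

theorem f_mem_V (m : ℕ) : f m ∈ V (2 * m) := by
  rw [f_eq]
  exact Submodule.add_mem _ (leftBump_mem_V m) (rightBump_mem_V m)

theorem g_mem_V (m : ℕ) : g m ∈ V (2 * m) := by
  rw [g_eq]
  exact Submodule.sub_mem _ (leftBump_mem_V m) (rightBump_mem_V m)

theorem V_mono : Monotone V := by
  intro n k hnk
  refine Submodule.span_mono (Set.image_mono (Set.Icc_subset_Icc ?_ ?_)) <;> omega

theorem exists_decay (m : ℕ) :
    ∃ K : ℝ, ∀ᵐ x : ℝ, |f m x| ≤ K * ((1 + |x|) ^ (m + 1))⁻¹ ∧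
      |g m x| ≤ K * ((1 + |x|) ^ (m + 1))⁻¹ := by
  obtain ⟨K, hK⟩ := exists_abs_binomialSinc_le m
  refine ⟨2 * K, ?_⟩
  rw [f_eq, g_eq]
  filter_upwards [Lp.coeFn_add (leftBump m) (rightBump m), Lp.coeFn_sub (leftBump m) (rightBump m),
    coeFn_leftBump m, coeFn_rightBump m] with x e1 e2 e3 e4
  rw [e1, e2, Pi.add_apply, Pi.sub_apply, e3, e4]
  have h1 := hK x
  have h2 := hK (-x)
  rw [abs_neg] at h2
  constructor
  · exact (abs_add_le _ _).trans (by linarith)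
  · exact (abs_sub _ _).trans (by linarith)

theorem le_signDist_f_g (m : ℕ) : 2 * √(m.centralBinom : ℝ) ≤ signDist (f m) (g m) := by
  have hl : ‖leftBump m‖ = √(m.centralBinom : ℝ) := by
    rw [← norm_sq_leftBump, Real.sqrt_sq (norm_nonneg _)]
  have hr : ‖rightBump m‖ = √(m.centralBinom : ℝ) := by
    rw [← norm_sq_rightBump, Real.sqrt_sq (norm_nonneg _)]
  have : Nonempty ({1, -1} : Set ℝ) := ⟨⟨1, by simp⟩⟩
  refine le_ciInf ?_
  rintro ⟨α, hα⟩
  rcases hα with rfl | hα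
  · have h : f m - (1 : ℝ) • g m = (2 : ℝ) • rightBump m := by
      rw [f_eq, g_eq]
      module
    rw [h, norm_smul, hr, Real.norm_ofNat]
  · rw [Set.mem_singleton_iff] at hα
    subst hα
    have h : f m - (-1 : ℝ) • g m = (2 : ℝ) • leftBump m := by
      rw [f_eq, g_eq]
      module
    rw [h, norm_smul, hl, Real.norm_ofNat]

/-- The reverse triangle inequality, used for both signs of `a - b`: the smaller of the two bumps
controls the amplitude difference. -/
theorem abs_abs_add_sub_abs_sub_le (a b : ℝ) :
    |(|a + b| - |a - b|)| ≤ 2 * |a| ∧ |(|a + b| - |a - b|)| ≤ 2 * |b| := by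
  constructor
  · rw [abs_sub_comm a b]
    refine (abs_abs_sub_abs_le (a + b) (b - a)).trans_eq ?_
    rw [show a + b - (b - a) = 2 * a by ring, abs_mul, abs_two]
  · refine (abs_abs_sub_abs_le (a + b) (a - b)).trans_eq ?_
    rw [show a + b - (a - b) = 2 * b by ring, abs_mul, abs_two]

/-- The left bump is small at `n ≥ 0` and the right one at `n ≤ 0`. Keeping both squares gives one
bound for all `n`, which the frame identity for `φ_{-4m}` and `φ_{4m}` sums. -/
theorem sq_amplitude_sub_le (m : ℕ) (n : ℤ) :
    (amplitude phi (f m) n - amplitude phi (g m) n) ^ 2 ≤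
      4 / (m.centralBinom : ℝ) ^ 2 * (|inner ℝ (phi (-(4 * (m : ℤ)))) (phi n)| ^ 2 +
        |inner ℝ (phi (4 * (m : ℤ))) (phi n)| ^ 2) := by
  have hC : (0 : ℝ) < m.centralBinom := by exact_mod_cast m.centralBinom_pos
  simp only [amplitude, f_eq, g_eq, inner_add_left, inner_sub_left, inner_leftBump_phi,
    inner_rightBump_phi, inner_phi_phi, sincFun]
  obtain ⟨h1, h2⟩ := abs_abs_add_sub_abs_sub_le (binomialSinc m (n / 4 + 2 * m))
    (binomialSinc m (-(n / 4) + 2 * m))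
  set d := |binomialSinc m (n / 4 + 2 * m) + binomialSinc m (-(n / 4) + 2 * m)| -
    |binomialSinc m (n / 4 + 2 * m) - binomialSinc m (-(n / 4) + 2 * m)| with hd
  push_cast
  set s := Real.sinc (Real.pi * ((n : ℝ) / 4 - -(4 * (m : ℝ)) / 4)) with hs
  set t := Real.sinc (Real.pi * ((n : ℝ) / 4 - 4 * (m : ℝ) / 4)) with ht
  have hs' : s = Real.sinc (Real.pi * (n / 4 + m)) := by
    rw [hs]
    congr 2
    ring
  have ht' : t = Real.sinc (Real.pi * (-(n / 4) + m)) := by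
    rw [ht, ← Real.sinc_neg]
    congr 1
    ring
  have key : m.centralBinom * |d| ≤ 2 * |s| ∨ m.centralBinom * |d| ≤ 2 * |t| := by
    rcases le_total 0 ((n : ℝ) / 4) with hn | hn
    · left
      have h3 := centralBinom_mul_abs_binomialSinc_le m hn
      rw [← hs'] at h3
      calc _ ≤ m.centralBinom * (2 * |binomialSinc m (n / 4 + 2 * m)|) := by gcongr
        _ ≤ _ := by linarith
    · right
      have h3 := centralBinom_mul_abs_binomialSinc_le m (neg_nonneg.2 hn)
      rw [← ht'] at h3
      calc _ ≤ m.centralBinom * (2 * |binomialSinc m (-(n / 4) + 2 * m)|) := by gcongr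
        _ ≤ _ := by linarith
  have key2 : (m.centralBinom * |d|) ^ 2 ≤ 4 * (|s| ^ 2 + |t| ^ 2) := by
    have h0 : 0 ≤ m.centralBinom * |d| := by positivity
    rcases key with h | h
    · nlinarith [pow_le_pow_left₀ h0 h 2, sq_nonneg |t|]
    · nlinarith [pow_le_pow_left₀ h0 h 2, sq_nonneg |s|]
  rw [mul_pow, sq_abs d] at key2
  rw [div_mul_eq_mul_div, le_div_iff₀ (by positivity)]
  linarith

theorem norm_phi_four_mul (l : ℤ) : ‖phi (4 * l)‖ = 1 :=
  orthonormal_phi_four_mul.1 l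

/-- Each of the two series sums to 4, so the squared distance is at most `32 / c² ≤ (6 / c)²`. -/
theorem amplitudeDist_f_g_le (m : ℕ) :
    amplitudeDist phi (f m) (g m) ≤ 6 / (m.centralBinom : ℝ) := by
  have hC : (0 : ℝ) < m.centralBinom := by exact_mod_cast m.centralBinom_pos
  have h1 := ((hasSum_sq_inner_phi (phi_mem_bandlimited (-(4 * (m : ℤ))))).add
    (hasSum_sq_inner_phi (phi_mem_bandlimited (4 * (m : ℤ))))).mul_left
    (4 / (m.centralBinom : ℝ) ^ 2)
  rw [show -(4 * (m : ℤ)) = 4 * (-m) by ring, norm_phi_four_mul, norm_phi_four_mul] at h1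
  have h2 := fun n => sq_amplitude_sub_le m n
  rw [show -(4 * (m : ℤ)) = 4 * (-m) by ring] at h2
  have h3 := (Summable.of_nonneg_of_le (fun n => sq_nonneg _) h2 h1.summable).tsum_le_tsum h2
    h1.summable
  rw [h1.tsum_eq] at h3
  rw [amplitudeDist]
  refine Real.sqrt_le_iff.2 ⟨by positivity, h3.trans ?_⟩
  rw [div_pow, div_mul_eq_mul_div]
  gcongr
  norm_num

theorem mul_amplitudeDist_lt_signDist (m : ℕ) :
    1 / 100 * ((m : ℝ) + 1)⁻¹ * 2 ^ (3 * m) * amplitudeDist phi (f m) (g m) <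
      signDist (f m) (g m) := by
  have hC : (0 : ℝ) < m.centralBinom := by exact_mod_cast m.centralBinom_pos
  refine lt_of_lt_of_le ?_ (le_signDist_f_g m)
  refine lt_of_le_of_lt (mul_le_mul_of_nonneg_left (amplitudeDist_f_g_le m) (by positivity)) ?_
  have h16 := sixteen_pow_le m
  set c : ℝ := (m.centralBinom : ℝ) with hc
  set M : ℝ := (m : ℝ) + 1 with hM
  have hM1 : 1 ≤ M := by
    have : (0 : ℝ) ≤ m := Nat.cast_nonneg m
    linarith
  set s : ℝ := √c with hs
  have hs0 : 0 < s := Real.sqrt_pos.2 hC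
  have hsq : s ^ 2 = c := Real.sq_sqrt hC.le
  have h8 : (2 : ℝ) ^ (3 * m) = 8 ^ m := by
    rw [pow_mul]
    norm_num
  -- This is the cube of `16^m ≤ 4 M c²` under a square root, with `M³` rounded up to `M⁴` to avoid
  -- fractional powers; hence the exponent `-1` of `m + 1` instead of `-3/4`.
  have h64 : ((8 : ℝ) ^ m) ^ 2 ≤ 8 * M ^ 2 * c ^ 3 := by
    refine (pow_le_pow_iff_left₀ (by positivity) (by positivity) two_ne_zero).1 ?_
    have e : (((8 : ℝ) ^ m) ^ 2) ^ 2 = (16 ^ m) ^ 3 := by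
      rw [← pow_mul, ← pow_mul, ← pow_mul, mul_comm m, mul_comm m, pow_mul, pow_mul _ 3]
      norm_num
    rw [e]
    calc ((16 : ℝ) ^ m) ^ 3 ≤ (4 * M * c ^ 2) ^ 3 := by gcongr
      _ = 64 * c ^ 6 * M ^ 3 := by ring
      _ ≤ 64 * c ^ 6 * M ^ 4 := by
        gcongr
        norm_num
      _ = _ := by ring
  have hlt : 3 / 100 * (8 : ℝ) ^ m < M * c * s := by
    refine lt_of_pow_lt_pow_left₀ 2 (by positivity) ?_
    have hpos : 0 < M ^ 2 * c ^ 3 := by positivity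
    calc (3 / 100 * (8 : ℝ) ^ m) ^ 2 = 9 / 10000 * (8 ^ m) ^ 2 := by ring
      _ < M ^ 2 * c ^ 3 := by nlinarith
      _ = (M * c * s) ^ 2 := by
        rw [mul_pow, mul_pow, hsq]
        ring
  rw [h8]
  have e : 1 / 100 * M⁻¹ * 8 ^ m * (6 / c) = 2 * (3 / 100 * 8 ^ m) / (M * c) := by
    field_simp
    ring
  rw [e, div_lt_iff₀ (by positivity)]
  linarith

end Stability

end SincFrame

end

theorem mainTheorem6 :
    -- the `φ_n` form a frame for the bandlimited functions and do phase retrieval there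
    SincFrame.IsFrameFor SincFrame.phi SincFrame.bandlimited ∧
    SincFrame.DoesPhaseRetrieval SincFrame.phi SincFrame.bandlimited ∧
    -- the `φ_{4ℓ}` are an orthonormal basis of the bandlimited functions, and `dim V_n = 2n + 1`
    Orthonormal ℝ (fun l : ℤ => SincFrame.phi (4 * l)) ∧
    (Submodule.span ℝ (Set.range fun l : ℤ => SincFrame.phi (4 * l))).topologicalClosure =
      SincFrame.bandlimited ∧
    (∀ n : ℕ, Module.finrank ℝ (SincFrame.V n) = 2 * n + 1) ∧
    -- `f_m` and `g_m` lie in `V_{2m}` and decay like `|x|^{-(m+1)}`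
    (∀ m : ℕ, SincFrame.f m ∈ SincFrame.V (2 * m) ∧ SincFrame.g m ∈ SincFrame.V (2 * m) ∧
      ∃ K : ℝ, ∀ᵐ x : ℝ, |SincFrame.f m x| ≤ K * ((1 + |x|) ^ (m + 1))⁻¹ ∧
        |SincFrame.g m x| ≤ K * ((1 + |x|) ^ (m + 1))⁻¹) ∧
    ∃ C : ℝ, 0 < C ∧
      -- the lower bound
      (∀ m : ℕ, C * ((m : ℝ) + 1)⁻¹ * 2 ^ (3 * m) *
          SincFrame.amplitudeDist SincFrame.phi (SincFrame.f m) (SincFrame.g m) <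
        SincFrame.signDist (SincFrame.f m) (SincFrame.g m)) ∧
      -- every stability function `G` for the spaces `V_k` grows exponentially
      (∀ G : ℕ → ℝ,
        (∀ k : ℕ, ∀ u ∈ SincFrame.V k, ∀ v ∈ SincFrame.V k,
          SincFrame.signDist u v ≤ G k * SincFrame.amplitudeDist SincFrame.phi u v) →
        ∀ m k : ℕ, 2 * m ≤ k → C * ((m : ℝ) + 1)⁻¹ * 2 ^ (3 * m) < G k) := by
  refine ⟨SincFrame.isFrameFor_phi, SincFrame.doesPhaseRetrieval_phi,
    SincFrame.orthonormal_phi_four_mul, SincFrame.topologicalClosure_span_phi_four_mul,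
    SincFrame.finrank_V,
    fun m => ⟨SincFrame.f_mem_V m, SincFrame.g_mem_V m, SincFrame.exists_decay m⟩,
    1 / 100, by norm_num, SincFrame.mul_amplitudeDist_lt_signDist, fun G hG m k hmk => ?_⟩
  have h := (SincFrame.mul_amplitudeDist_lt_signDist m).trans_le
    (hG k _ (SincFrame.V_mono hmk (SincFrame.f_mem_V m)) _
      (SincFrame.V_mono hmk (SincFrame.g_mem_V m)))
  -- Cancelling the amplitude distance from a strict inequality needs only that it is nonnegative.
  exact lt_of_mul_lt_mul_right h (Real.sqrt_nonneg _)
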